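/- Let $C$ be a field of characteristic zero and let $A$ be a commutative $C$-algebra with identity that is an integral domain. For $\lambda\in C$, let \[ Ш_C(A)=Ш_{C,\lambda}(A)=\bigoplus_{k\ge 0}A^{\otimes (k+1)} \] (tensor products over $C$) be the shuffle Baxter algebra of weight $\lambda$ on $A$. Its product is the mixed shuffle product, i.e. the bilinear product given on pure tensors $x=x_0\otimes x_1\otimes\cdots\otimes x_m$, $y=y_0\otimes y_1\otimes\cdots\otimes y_n$ by \[ x\,y=\sum_{(\sigma,T)}\lambda^{|T|}\;x_0y_0\otimes\sigma(x^+\otimes y^+;T). \] Here $x^+=x_1\otimes\cdots\otimes x_m$ and $y^+=y_1\otimes\cdots\otimes y_n$. The sum runs over all pairs $(\sigma,T)$ where $\sigma\in S_{m+n}$ satisfies $\sigma^{-1}(1)<\cdots<\sigma^{-1}(m)$ and $\sigma^{-1}(m+1)<\cdots<\sigma^{-1}(m+n)$, and where $T$ is a set of pairs $(k,k+1)$ with $1\le k<m+n$ and $\sigma(k)\le m<\sigma(k+1)$. With $u=(x_1,\dots,x_m,y_1,\dots,y_n)$, the tensor $\sigma(x^+\otimes y^+;T)\in A^{\otimes(m+n-|T|)}$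 is obtained from $u_{\sigma(1)}\otimes\cdots\otimes u_{\sigma(m+n)}$ by replacing, for each $(k,k+1)\in T$, the sign $\otimes$ between $u_{\sigma(k)}$ and $u_{\sigma(k+1)}$ by multiplication in $A$. With this product $Ш_C(A)$ is a commutative ring with identity $1_A\in A$. For $k\ge 0$ let $\mathrm{Fil}^k=\bigoplus_{n\ge k}A^{\otimes(n+1)}$, which is an ideal, and let $\widehat{Ш}_C(A)=\varprojlim_k Ш_C(A)/\mathrm{Fil}^k$ be the completion. Its elements are the infinite sums $\sum_{n\ge0}a_n$ with $a_n\in A^{\otimes(n+1)}$. Write $1^{\otimes n}=1_A\otimes\cdots\otimes 1_A\in A^{\otimes n}$. Then: 1. $Ш_C(A)$ is an integral domain for every $\lambda\in C$. 2. For every $\lambda\in C$, $\widehat{Ш}_C(A)$ is an integral domain if and only if $\lambda=0$. 3. If $\lambda\ne0$, then the elements \[ x=1^{\otimes 2},\qquad y=\sum_{n=0}^\infty(-\lambda)^{-n}\,1^{\otimes(n+1)} \] of $\widehat{Ш}_C(A)$ are both nonzero and satisfy $xy=0$. -/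

import Mathlib

open scoped TensorProduct

/-- A mixable `(m, n)`-shuffle `(σ, T)`.  Positions and letters are numbered from `0`, so that the
letters `< m` are those of the first word.  The permutation `σ` is an `(m, n)`-shuffle, and `T` is
a set of admissible pairs `(k, k + 1)` of `σ`, each recorded by its first entry `k`. -/
@[ext]
structure MixableShuffle (m n : ℕ) where
  perm : Equiv.Perm (Fin (m + n))
  T : Finset (Fin (m + n))
  left_lt : ∀ i j : Fin m, i < j → perm.symm (Fin.castAdd n i) < perm.symm (Fin.castAdd n j)
  right_lt : ∀ i j : Fin n, i < j → perm.symm (Fin.natAdd m i) < perm.symm (Fin.natAdd m j)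
  admissible : ∀ k ∈ T, ∃ h : (k : ℕ) + 1 < m + n,
    (perm k : ℕ) < m ∧ m ≤ (perm ⟨(k : ℕ) + 1, h⟩ : ℕ)

namespace MixableShuffle

variable {m n : ℕ}

noncomputable instance : Fintype (MixableShuffle m n) :=
  Fintype.ofInjective (fun s => (s.perm, s.T)) (by
    intro s t h
    simp only [Prod.mk.injEq] at h
    exact MixableShuffle.ext h.1 h.2)

/-- The number of tensor factors left after the pairs in `T` have been merged. -/
abbrev len (s : MixableShuffle m n) : ℕ := m + n - s.T.card

theorem block_lt (s : MixableShuffle m n) (k : Fin (m + n)) :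
    (Finset.univ.filter fun t => t < k ∧ t ∉ s.T).card < s.len := by
  classical
  have hc : s.len = (Finset.univ.filter fun t => t ∉ s.T).card := by
    rw [← Finset.compl_filter, Finset.card_compl]
    simp [len]
  rw [hc]
  apply Finset.card_lt_card
  rw [Finset.ssubset_iff_of_subset (fun t ht => by simp at ht ⊢; exact ht.2)]
  have hpos := k.2
  refine ⟨⟨m + n - 1, by omega⟩, ?_, ?_⟩
  · simp only [Finset.mem_filter, Finset.mem_univ, true_and]
    intro h
    obtain ⟨h1, -⟩ := s.admissible _ h
    simp only at h1
    omega
  · simp only [Finset.mem_filter, Finset.mem_univ, true_and, not_and]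
    intro h
    rw [Fin.lt_def] at h
    simp only at h
    omega

/-- The tensor factor into which position `k` falls after the merging: the number of positions
`t < k` such that `(t, t + 1)` is not merged. -/
def block (s : MixableShuffle m n) (k : Fin (m + n)) : Fin s.len :=
  ⟨(Finset.univ.filter fun t => t < k ∧ t ∉ s.T).card, s.block_lt k⟩

/-- The mixable shuffle `σ(x ⊗ y; T)` of two words: its `j`-th factor is the product of the letters
`u_{σ(k)}`, where `u` is the concatenation of `x` and `y` and `k` runs over the positions that fall
into the factor `j`. -/
def word {A : Type*} [CommMonoid A] (s : MixableShuffle m n) (x : Fin m → A) (y : Fin n → A) :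
    Fin s.len → A :=
  fun j => ∏ k with s.block k = j, Fin.append x y (s.perm k)

/-- The factor that receives the `i`-th letter of the first word. -/
def left (s : MixableShuffle m n) (i : Fin m) : Fin s.len :=
  s.block (s.perm.symm (Fin.castAdd n i))

/-- The factor that receives the `i`-th letter of the second word. -/
def right (s : MixableShuffle m n) (i : Fin n) : Fin s.len :=
  s.block (s.perm.symm (Fin.natAdd m i))

theorem word_apply {A : Type*} [CommMonoid A] (s : MixableShuffle m n) (x : Fin m → A)
    (y : Fin n → A) (j : Fin s.len) :
    s.word x y j = (∏ i, if s.left i = j then x i else 1) *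
      ∏ i, if s.right i = j then y i else 1 := by
  rw [word, Finset.prod_filter, ← Equiv.prod_comp s.perm.symm, Fin.prod_univ_add]
  simp [left, right]
  rfl

theorem block_mono (s : MixableShuffle m n) : Monotone s.block := by
  intro a b hab
  rw [Fin.le_def]
  dsimp only [block]
  apply Finset.card_le_card
  intro t ht
  simp at ht ⊢
  exact ⟨ht.1.trans_le hab, ht.2⟩

theorem block_lt_of_notMem (s : MixableShuffle m n) {a b : Fin (m + n)} {t : Fin (m + n)}
    (hat : a ≤ t) (htb : t < b) (ht : t ∉ s.T) : s.block a < s.block b := by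
  rw [Fin.lt_def]
  dsimp only [block]
  apply Finset.card_lt_card
  rw [Finset.ssubset_iff_of_subset]
  · exact ⟨t, by simp [htb, ht], by simp [hat]⟩
  · intro t ht
    simp at ht ⊢
    exact ⟨ht.1.trans (hat.trans_lt htb), ht.2⟩

theorem mem_of_block_eq (s : MixableShuffle m n) {a b t : Fin (m + n)}
    (h : s.block a = s.block b) (hat : a ≤ t) (htb : t < b) : t ∈ s.T := by
  by_contra ht
  exact absurd h (s.block_lt_of_notMem hat htb ht).ne

/-- Distinct positions in one factor are an admissible pair. -/
theorem of_block_eq (s : MixableShuffle m n) {a b : Fin (m + n)}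
    (h : s.block a = s.block b) (hab : a < b) :
    a ∈ s.T ∧ (b : ℕ) = a + 1 ∧ (s.perm a : ℕ) < m ∧ m ≤ (s.perm b : ℕ) := by
  have ha := s.mem_of_block_eq h le_rfl hab
  obtain ⟨h1, h2, h3⟩ := s.admissible a ha
  rw [Fin.lt_def] at hab
  rcases Nat.lt_or_ge ((a : ℕ) + 1) b with hb | hb
  · have := s.mem_of_block_eq (t := ⟨a + 1, h1⟩) h (by rw [Fin.le_def]; simp) hb
    obtain ⟨-, h5, -⟩ := s.admissible _ this
    omega
  · have : (b : ℕ) = a + 1 := by omega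
    refine ⟨ha, this, h2, ?_⟩
    convert h3

theorem block_succ (s : MixableShuffle m n) {a b : Fin (m + n)} (ha : a ∈ s.T)
    (hb : (b : ℕ) = a + 1) : s.block a = s.block b := by
  rw [Fin.ext_iff]
  unfold block
  simp only
  congr 1
  ext t
  simp only [Finset.mem_filter, Finset.mem_univ, true_and, Fin.lt_def, hb]
  constructor
  · rintro ⟨h1, h2⟩
    exact ⟨by omega, h2⟩
  · rintro ⟨h1, h2⟩
    refine ⟨?_, h2⟩
    rcases Nat.lt_or_ge (t : ℕ) a with h | h
    · exact h
    · have : t = a := Fin.ext (by omega)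
      exact absurd (this ▸ ha) h2

theorem block_surjective (s : MixableShuffle m n) : Function.Surjective s.block := by
  classical
  have hinj : Function.Injective (fun t : {t // t ∉ s.T} => s.block t) := by
    intro a b h
    by_contra hne
    rcases lt_or_gt_of_ne hne with hl | hl
    · exact absurd h (s.block_lt_of_notMem le_rfl hl a.2).ne
    · exact absurd h (s.block_lt_of_notMem le_rfl hl b.2).ne'
  have hbij := (Fintype.bijective_iff_injective_and_card _).2 ⟨hinj, by simp [len]⟩
  intro j
  obtain ⟨t, ht⟩ := hbij.2 j
  exact ⟨t, ht⟩

theorem left_strictMono (s : MixableShuffle m n) : StrictMono s.left := by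
  intro i j hij
  have h := s.left_lt i j hij
  refine lt_of_le_of_ne (s.block_mono h.le) fun he => ?_
  obtain ⟨-, -, -, h4⟩ := s.of_block_eq he h
  simp at h4
  omega

theorem right_strictMono (s : MixableShuffle m n) : StrictMono s.right := by
  intro i j hij
  have h := s.right_lt i j hij
  refine lt_of_le_of_ne (s.block_mono h.le) fun he => ?_
  obtain ⟨-, -, h3, -⟩ := s.of_block_eq he h
  simp at h3

theorem append_left_right (s : MixableShuffle m n) (i : Fin (m + n)) :
    Fin.append s.left s.right i = s.block (s.perm.symm i) := by
  induction i using Fin.addCases <;> simp [left, right]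

theorem left_or_right (s : MixableShuffle m n) (j : Fin s.len) :
    (∃ i, s.left i = j) ∨ ∃ i, s.right i = j := by
  obtain ⟨k, hk⟩ := s.block_surjective j
  obtain ⟨i, rfl⟩ := s.perm.symm.surjective k
  induction i using Fin.addCases with
  | left i => exact Or.inl ⟨i, hk⟩
  | right i => exact Or.inr ⟨i, hk⟩

theorem card_T_le (s : MixableShuffle m n) : s.T.card ≤ m + n := by
  simpa using Finset.card_le_univ s.T

/-- The number of factors that receive two letters. -/
theorem card_both (s : MixableShuffle m n) :
    (Finset.univ.filter fun j => (∃ i, s.left i = j) ∧ ∃ i, s.right i = j).card = s.T.card := by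
  have h := Finset.card_union_add_card_inter (Finset.univ.image s.left) (Finset.univ.image s.right)
  rw [Finset.card_image_of_injective _ s.left_strictMono.injective,
    Finset.card_image_of_injective _ s.right_strictMono.injective] at h
  have h1 : Finset.univ.image s.left ∪ Finset.univ.image s.right = Finset.univ := by
    ext j
    simpa using s.left_or_right j
  have := s.card_T_le
  rw [h1] at h
  simp only [Finset.card_univ, Fintype.card_fin] at h
  trans (Finset.univ.image s.left ∩ Finset.univ.image s.right).card
  · congr 1
    ext j
    simp
  · simp only [len] at h ⊢
    omega

theorem le_len_left (s : MixableShuffle m n) : m ≤ s.len := by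
  simpa using Fintype.card_le_of_injective _ s.left_strictMono.injective

theorem le_len_right (s : MixableShuffle m n) : n ≤ s.len := by
  simpa using Fintype.card_le_of_injective _ s.right_strictMono.injective

/-- A mixable shuffle, followed by an increasing map of its factors into `Fin N`, yields two
increasing maps into `Fin N`. -/
def split (N : ℕ) (q : Σ s : MixableShuffle m n, Fin s.len ↪o Fin N) :
    (Fin m ↪o Fin N) × (Fin n ↪o Fin N) :=
  (OrderEmbedding.ofStrictMono (q.2 ∘ q.1.left) (q.2.strictMono.comp q.1.left_strictMono),
    OrderEmbedding.ofStrictMono (q.2 ∘ q.1.right) (q.2.strictMono.comp q.1.right_strictMono))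

theorem append_split (N : ℕ) (s : MixableShuffle m n) (h : Fin s.len ↪o Fin N) (k : Fin (m + n)) :
    Fin.append (h ∘ s.left) (h ∘ s.right) (s.perm k) = h (s.block k) := by
  have := s.append_left_right (s.perm k)
  rw [Equiv.symm_apply_apply] at this
  rw [← this]
  generalize s.perm k = i
  induction i using Fin.addCases <;> simp

theorem perm_eq_sort (N : ℕ) (s : MixableShuffle m n) (h : Fin s.len ↪o Fin N) :
    s.perm = Tuple.sort (Fin.append (h ∘ s.left) (h ∘ s.right)) := by
  rw [Tuple.eq_sort_iff]
  constructor
  · intro a b hab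
    simp only [Function.comp_apply, append_split]
    exact h.monotone (s.block_mono hab)
  · intro a b hab he
    rw [append_split, append_split, h.injective.eq_iff] at he
    obtain ⟨-, -, h1, h2⟩ := s.of_block_eq he hab
    rw [Fin.lt_def]
    omega

theorem split_injective (N : ℕ) : Function.Injective (split (m := m) (n := n) N) := by
  rintro ⟨s, h⟩ ⟨s', h'⟩ he
  simp only [split, Prod.mk.injEq] at he
  have hl : h ∘ s.left = h' ∘ s'.left := congrArg (fun e : Fin m ↪o Fin N => (e : Fin m → Fin N)) he.1
  have hr : h ∘ s.right = h' ∘ s'.right :=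
    congrArg (fun e : Fin n ↪o Fin N => (e : Fin n → Fin N)) he.2
  have hp : s.perm = s'.perm := by rw [perm_eq_sort N s h, perm_eq_sort N s' h', hl, hr]
  have hb : ∀ k, h (s.block k) = h' (s'.block k) := by
    intro k
    rw [← append_split, ← append_split, hl, hr, hp]
  have hT : s.T = s'.T := by
    ext k
    constructor
    · intro hk
      obtain ⟨h1, -⟩ := s.admissible k hk
      have := s.block_succ (b := ⟨k + 1, h1⟩) hk rfl
      have h2 : s'.block k = s'.block ⟨k + 1, h1⟩ := h'.injective (by rw [← hb, ← hb, this])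
      exact (s'.of_block_eq h2 (by rw [Fin.lt_def]; simp)).1
    · intro hk
      obtain ⟨h1, -⟩ := s'.admissible k hk
      have := s'.block_succ (b := ⟨k + 1, h1⟩) hk rfl
      have h2 : s.block k = s.block ⟨k + 1, h1⟩ := h.injective (by rw [hb, hb, this])
      exact (s.of_block_eq h2 (by rw [Fin.lt_def]; simp)).1
  obtain rfl : s = s' := MixableShuffle.ext hp hT
  congr 1
  ext j
  obtain ⟨k, rfl⟩ := s.block_surjective j
  rw [hb]

theorem split_surjective (N : ℕ) : Function.Surjective (split (m := m) (n := n) N) := by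
  rintro ⟨f, g⟩
  set w : Fin (m + n) → Fin N := Fin.append f g with hw
  set σ := Tuple.sort w with hσ
  obtain ⟨hmono, htie⟩ := (Tuple.eq_sort_iff (f := w) (σ := σ)).1 rfl
  have key : ∀ a b, w (σ a) < w (σ b) → a < b := by
    intro a b hab
    by_contra hba
    exact absurd (hmono (not_lt.1 hba)) (not_le.2 hab)
  have hadm : ∀ a b, a < b → w (σ a) = w (σ b) → (σ a : ℕ) < m ∧ m ≤ (σ b : ℕ) := by
    intro a b hab he
    have hlt := htie a b hab he
    revert he hlt
    generalize σ a = u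
    generalize σ b = v
    induction u using Fin.addCases with
    | left i =>
      induction v using Fin.addCases with
      | left j =>
        intro he hlt
        simp only [hw, Fin.append_left] at he
        rw [f.injective he] at hlt
        exact absurd hlt (lt_irrefl _)
      | right j => intro _ _; simp
    | right i =>
      induction v using Fin.addCases with
      | left j =>
        intro _ hlt
        rw [Fin.lt_def] at hlt
        simp at hlt
        omega
      | right j =>
        intro he hlt
        simp only [hw, Fin.append_right] at he
        rw [g.injective he] at hlt
        exact absurd hlt (lt_irrefl _)
  classical
  let s : MixableShuffle m n :=
    { perm := σ
      T := Finset.univ.filter fun k => ∃ h : (k : ℕ) + 1 < m + n, w (σ k) = w (σ ⟨k + 1, h⟩)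
      left_lt := by
        intro i j hij
        apply key
        simpa [hw] using hij
      right_lt := by
        intro i j hij
        apply key
        simpa [hw] using hij
      admissible := by
        intro k hk
        simp only [Finset.mem_filter, Finset.mem_univ, true_and] at hk
        obtain ⟨h1, h2⟩ := hk
        exact ⟨h1, hadm _ _ (by rw [Fin.lt_def]; simp) h2⟩ }
  have hbw : ∀ a b, a < b → s.block a < s.block b → w (σ a) < w (σ b) := by
    intro a b hab hlt
    refine lt_of_le_of_ne (hmono hab.le) fun he => ?_
    refine absurd hlt ?_
    obtain ⟨d, hd⟩ : ∃ d, (b : ℕ) = a + d := ⟨b - a, by rw [Fin.lt_def] at hab; omega⟩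
    have : (b : ℕ) = a + 1 := by
      by_contra hne
      rw [Fin.lt_def] at hab
      have hbl := b.2
      let c : Fin (m + n) := ⟨a + 1, by omega⟩
      have hac : a < c := by rw [Fin.lt_def]; simp [c]
      have hcb : c < b := by rw [Fin.lt_def]; simp only [c]; omega
      have e1 : w (σ a) = w (σ c) :=
        le_antisymm (hmono hac.le) ((hmono hcb.le).trans he.ge)
      have h1 := hadm a c hac e1
      have h2 := hadm c b hcb (e1.symm.trans he)
      omega
    have hbl := b.2
    have hmem : a ∈ s.T := by
      simp only [s, Finset.mem_filter, Finset.mem_univ, true_and]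
      refine ⟨by omega, he.trans ?_⟩
      congr 2
      exact Fin.ext this
    rw [s.block_succ hmem this]
    exact lt_irrefl _
  have hwb : ∀ a b, s.block a = s.block b → w (σ a) = w (σ b) := by
    have : ∀ a b, a < b → s.block a = s.block b → w (σ a) = w (σ b) := by
      intro a b hab he
      obtain ⟨hm, hb, -⟩ := s.of_block_eq he hab
      simp only [s, Finset.mem_filter, Finset.mem_univ, true_and] at hm
      obtain ⟨h1, h2⟩ := hm
      rw [h2]
      congr 2
      exact Fin.ext hb.symm
    intro a b he
    rcases lt_trichotomy a b with h | h | h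
    · exact this a b h he
    · rw [h]
    · exact (this b a h he.symm).symm
  let c := Function.surjInv s.block_surjective
  have hc : ∀ j, s.block (c j) = j := Function.surjInv_eq s.block_surjective
  have hsm : StrictMono fun j => w (σ (c j)) := by
    intro i j hij
    have hlt : s.block (c i) < s.block (c j) := by rwa [hc, hc]
    refine hbw _ _ ?_ hlt
    by_contra hle
    exact absurd (s.block_mono (not_lt.1 hle)) (not_le.2 hlt)
  refine ⟨⟨s, OrderEmbedding.ofStrictMono _ hsm⟩, ?_⟩
  simp only [split, Prod.mk.injEq]
  constructor
  · ext i
    simp only [OrderEmbedding.coe_ofStrictMono, Function.comp_apply, left]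
    rw [hwb _ _ (hc _)]
    simp [s, hw]
  · ext i
    simp only [OrderEmbedding.coe_ofStrictMono, Function.comp_apply, right]
    rw [hwb _ _ (hc _)]
    simp [s, hw]

end MixableShuffle

universe u v

/-- The tensor power `A^{⊗ n}` over `C`. -/
abbrev TPow (C : Type u) (A : Type v) [CommRing C] [CommRing A] [Algebra C A] (n : ℕ) :
    Type (max u v) :=
  PiTensorProduct C fun _ : Fin n => A

namespace TPow

variable {C : Type u} {A : Type v} [CommRing C] [CommRing A] [Algebra C A]
variable {B : Type v} [CommRing B] [Algebra C B]

/-- The linear map `A^{⊗ m} → B^{⊗ k}` that sends `a_0 ⊗ ⋯ ⊗ a_{m-1}` to the tensor whose `j`-th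
factor is the product of the `φ_i (a_i)` over all `i` with `p i = j`. -/
noncomputable def merge {m k : ℕ} (φ : Fin m → A →ₗ[C] B) (p : Fin m → Fin k) :
    TPow C A m →ₗ[C] TPow C B k :=
  PiTensorProduct.lift ((MultilinearMap.mkPiAlgebra C (Fin m) (TPow C B k)).compLinearMap
    fun i => (PiTensorProduct.singleAlgHom (R := C) (A := fun _ : Fin k => B) (p i)).toLinearMap ∘ₗ
      φ i)

theorem merge_tprod {m k : ℕ} (φ : Fin m → A →ₗ[C] B) (p : Fin m → Fin k) (a : Fin m → A) :
    merge φ p (PiTensorProduct.tprod C a) =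
      PiTensorProduct.tprod C fun j => ∏ i, if p i = j then φ i (a i) else 1 := by
  simp only [merge, PiTensorProduct.lift.tprod, MultilinearMap.compLinearMap_apply,
    MultilinearMap.mkPiAlgebra_apply, LinearMap.comp_apply, AlgHom.toLinearMap_apply,
    PiTensorProduct.singleAlgHom_apply]
  rw [← PiTensorProduct.tprod_prod]
  congr 1
  ext j
  rw [Finset.prod_apply]
  refine Finset.prod_congr rfl fun i _ => ?_
  simp only [MonoidHom.mulSingle_apply, Pi.mulSingle_apply, eq_comm]

end TPow

/-- Extends a map of positions by the position `0` of the leading factor. -/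
def liftPos {m k : ℕ} (f : Fin m → Fin k) : Fin (m + 1) → Fin (k + 1) :=
  Fin.cons 0 fun i => (f i).succ

namespace MixableShuffle

variable {C : Type u} {A : Type v} [CommRing C] [CommRing A] [Algebra C A] {m n : ℕ}

/-- The bilinear map `(x, y) ↦ x_0 y_0 ⊗ σ(x⁺ ⊗ y⁺; T)` on tensors; see `prodTerm_tprod`. -/
noncomputable def prodTerm (s : MixableShuffle m n) :
    TPow C A (m + 1) →ₗ[C] TPow C A (n + 1) →ₗ[C] TPow C A (s.len + 1) :=
  (LinearMap.mul C (TPow C A (s.len + 1))).compl₁₂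
    (TPow.merge (fun _ => LinearMap.id) (liftPos s.left))
    (TPow.merge (fun _ => LinearMap.id) (liftPos s.right))

/-- The formula `x_0 y_0 ⊗ σ(x⁺ ⊗ y⁺; T)` on pure tensors, which determines `prodTerm`. -/
theorem prodTerm_tprod (s : MixableShuffle m n) (x : Fin (m + 1) → A) (y : Fin (n + 1) → A) :
    s.prodTerm (PiTensorProduct.tprod C x) (PiTensorProduct.tprod C y) =
      PiTensorProduct.tprod C
        (Fin.cons (x 0 * y 0) (s.word (Fin.tail x) (Fin.tail y)) : Fin (s.len + 1) → A) := by
  simp only [prodTerm, LinearMap.compl₁₂_apply, TPow.merge_tprod, LinearMap.mul_apply',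
    PiTensorProduct.tprod_mul_tprod]
  congr 1
  ext j
  induction j using Fin.cases with
  | zero => simp [Fin.prod_univ_succ, liftPos]
  | succ j =>
    simp [Fin.prod_univ_succ, liftPos, word_apply, Fin.tail, (Fin.succ_ne_zero j).symm]

end MixableShuffle

/-- The module underlying the shuffle Baxter algebra `Ш_C(A)` of weight `lam`: the direct sum of
the tensor powers `A^{⊗ (k + 1)}`, `k ≥ 0`.  It carries the mixed shuffle product of weight
`lam`, which is the only place where the weight enters. -/
def Sha (C : Type u) (A : Type v) [CommRing C] [CommRing A] [Algebra C A] (_lam : C) :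
    Type (max u v) :=
  DirectSum ℕ fun k => TPow C A (k + 1)

namespace Sha

variable {C : Type u} {A : Type v} [CommRing C] [CommRing A] [Algebra C A] {lam : C}

noncomputable instance : AddCommGroup (Sha C A lam) :=
  inferInstanceAs (AddCommGroup (DirectSum ℕ fun k => TPow C A (k + 1)))

noncomputable instance : Module C (Sha C A lam) :=
  inferInstanceAs (Module C (DirectSum ℕ fun k => TPow C A (k + 1)))

variable (C A lam) in
/-- The inclusion of the summand `A^{⊗ (k + 1)}`. -/
noncomputable def of (k : ℕ) : TPow C A (k + 1) →ₗ[C] Sha C A lam :=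
  DirectSum.lof C ℕ (fun k => TPow C A (k + 1)) k

variable (C A lam) in
/-- The component in `A^{⊗ (k + 1)}`. -/
noncomputable def coeff (k : ℕ) : Sha C A lam →ₗ[C] TPow C A (k + 1) :=
  DirectSum.component C ℕ (fun k => TPow C A (k + 1)) k

theorem coeff_of_self (k : ℕ) (x : TPow C A (k + 1)) :
    coeff C A lam k (of C A lam k x) = x :=
  DirectSum.component.lof_self _ _ _

theorem coeff_of_ne {j k : ℕ} (h : j ≠ k) (x : TPow C A (k + 1)) :
    coeff C A lam j (of C A lam k x) = 0 := by
  exact (DirectSum.component.of C (M := fun k => TPow C A (k + 1)) j k x).trans (dif_neg h.symm)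

theorem ext_coeff {x y : Sha C A lam} (h : ∀ k, coeff C A lam k x = coeff C A lam k y) : x = y :=
  DirectSum.ext_component C h

theorem linearMap_ext {M : Type*} [AddCommGroup M] [Module C M] {f g : Sha C A lam →ₗ[C] M}
    (h : ∀ (k : ℕ) (a : Fin (k + 1) → A), f (of C A lam k (PiTensorProduct.tprod C a)) =
      g (of C A lam k (PiTensorProduct.tprod C a))) : f = g := by
  refine DirectSum.linearMap_ext C fun k => PiTensorProduct.ext ?_
  ext a
  exact h k a

/-- The linear map on `Ш_C(A)` with prescribed restrictions to the summands. -/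
noncomputable def lift {M : Type*} [AddCommGroup M] [Module C M]
    (φ : ∀ k, TPow C A (k + 1) →ₗ[C] M) : Sha C A lam →ₗ[C] M :=
  DirectSum.toModule C ℕ M φ

theorem lift_of {M : Type*} [AddCommGroup M] [Module C M]
    (φ : ∀ k, TPow C A (k + 1) →ₗ[C] M) (k : ℕ) (x : TPow C A (k + 1)) :
    lift φ (of C A lam k x) = φ k x :=
  DirectSum.toModule_lof C (ι := ℕ) (M := fun k => TPow C A (k + 1)) k x

variable (C A lam) in
/-- The mixed shuffle product of weight `lam` as a bilinear map: on `A^{⊗ (m + 1)}` and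
`A^{⊗ (n + 1)}` it is the sum over all mixable `(m, n)`-shuffles `(σ, T)` of
`lam ^ |T|` times `x_0 y_0 ⊗ σ(x⁺ ⊗ y⁺; T)`. -/
noncomputable def mulMap : Sha C A lam →ₗ[C] Sha C A lam →ₗ[C] Sha C A lam :=
  lift fun m => LinearMap.flip <| lift fun n =>
    LinearMap.flip <| ∑ s : MixableShuffle m n,
      lam ^ s.T.card • s.prodTerm.compr₂ (of C A lam s.len)

noncomputable instance : Mul (Sha C A lam) := ⟨fun x y => mulMap C A lam x y⟩

theorem mul_def (x y : Sha C A lam) : x * y = mulMap C A lam x y := rfl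

theorem of_mul_of (m n : ℕ) (x : TPow C A (m + 1)) (y : TPow C A (n + 1)) :
    of C A lam m x * of C A lam n y =
      ∑ s : MixableShuffle m n, lam ^ s.T.card • of C A lam s.len (s.prodTerm x y) := by
  rw [mul_def, mulMap, lift_of, LinearMap.flip_apply, lift_of]
  simp [LinearMap.sum_apply]

/-- The mixed shuffle product of two pure tensors. -/
theorem tprod_mul_tprod (m n : ℕ) (x : Fin (m + 1) → A) (y : Fin (n + 1) → A) :
    of C A lam m (PiTensorProduct.tprod C x) * of C A lam n (PiTensorProduct.tprod C y) =
      ∑ s : MixableShuffle m n, lam ^ s.T.card • of C A lam s.len (PiTensorProduct.tprod C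
        (Fin.cons (x 0 * y 0) (s.word (Fin.tail x) (Fin.tail y)) : Fin (s.len + 1) → A)) := by
  simp only [of_mul_of, MixableShuffle.prodTerm_tprod]

noncomputable instance : One (Sha C A lam) := ⟨of C A lam 0 (PiTensorProduct.tprod C fun _ => 1)⟩

theorem one_def : (1 : Sha C A lam) = of C A lam 0 (PiTensorProduct.tprod C fun _ => 1) := rfl

/-! The ring axioms are checked by embedding `Ш_C(A)` into a product of tensor algebras. -/

section Embedding

variable (lam)

/-- `A ⊕ A ω` with `ω * ω = lam ω`. -/
abbrev QExt : Type v := QuadraticAlgebra A 0 (algebraMap C A lam)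

/-- `a ↦ a ω` -/
def iotaMap : A →ₗ[C] QExt (A := A) lam where
  toFun a := ⟨0, a⟩
  map_add' a b := by ext <;> simp
  map_smul' c a := by ext <;> simp

/-- `a ω + b ↦ a` -/
def imMap : QExt (A := A) lam →ₗ[C] A where
  toFun a := a.im
  map_add' a b := by simp
  map_smul' c a := by simp

/-- `a ω + b ↦ b` -/
def reMap : QExt (A := A) lam →ₗ[C] A where
  toFun a := a.re
  map_add' a b := by simp
  map_smul' c a := by simp

/-- `a ↦ a` -/
def inclMap : A →ₗ[C] QExt (A := A) lam where
  toFun a := ⟨a, 0⟩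
  map_add' a b := by ext <;> simp
  map_smul' c a := by ext <;> simp

theorem iotaMap_mul (a b : A) :
    iotaMap lam a * iotaMap lam b = lam • iotaMap (C := C) lam (a * b) := by
  ext
  · simp [iotaMap]
  · simp [iotaMap, ← Algebra.smul_def]

theorem inclMap_mul (a b : A) :
    inclMap lam a * inclMap lam b = inclMap (C := C) lam (a * b) := by
  ext <;> simp [inclMap]

/-- `a_0 ⊗ a_1 ⊗ ⋯ ↦ a_0 ⊗ a_1 ω ⊗ ⋯` with the factors placed according to `f`. -/
noncomputable def place {m N : ℕ} (f : Fin m → Fin N) :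
    TPow C A (m + 1) →ₗ[C] TPow C (QExt (A := A) lam) (N + 1) :=
  TPow.merge (Fin.cons (inclMap lam) fun _ => iotaMap lam) (liftPos f)

/-- The tensor `place f (a)`, factor by factor. -/
noncomputable def placeWord {m N : ℕ} (f : Fin m → Fin N) (a : Fin (m + 1) → A) :
    Fin (N + 1) → QExt (A := A) lam :=
  Fin.cons (inclMap lam (a 0)) fun j => ∏ i, if f i = j then iotaMap lam (a i.succ) else 1

theorem place_tprod {m N : ℕ} (f : Fin m → Fin N) (a : Fin (m + 1) → A) :
    place lam f (PiTensorProduct.tprod C a) = PiTensorProduct.tprod C (placeWord lam f a) := by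
  rw [place, TPow.merge_tprod]
  congr 1
  ext1 j
  induction j using Fin.cases with
  | zero => simp [Fin.prod_univ_succ, liftPos, placeWord]
  | succ j => simp [Fin.prod_univ_succ, liftPos, placeWord, (Fin.succ_ne_zero j).symm]

theorem prod_ite_of_injective {ι κ M : Type*} [Fintype ι] [DecidableEq κ] [CommMonoid M]
    {f : ι → κ} (hf : Function.Injective f) (v : ι → M) (i : ι) :
    (∏ l, if f l = f i then v l else 1) = v i := by
  classical
  rw [Finset.prod_eq_single i] <;> simp +contextual [hf.eq_iff]

theorem prod_ite_of_notMem {ι κ M : Type*} [Fintype ι] [DecidableEq κ] [CommMonoid M]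
    {f : ι → κ} (v : ι → M) (j : κ) (hj : ∀ i, f i ≠ j) :
    (∏ l, if f l = j then v l else 1) = 1 :=
  Finset.prod_eq_one fun l _ => if_neg (hj l)

theorem placeWord_mul {m n N : ℕ} (s : MixableShuffle m n) (h : Fin s.len ↪o Fin N)
    (x : Fin (m + 1) → A) (y : Fin (n + 1) → A) (j : Fin N) :
    placeWord lam (h ∘ s.left) x j.succ * placeWord lam (h ∘ s.right) y j.succ =
      (if ∃ l, h l = j ∧ (∃ i, s.left i = l) ∧ ∃ i, s.right i = l then lam else 1) •
        placeWord (C := C) lam h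
          (Fin.cons (x 0 * y 0) (s.word (Fin.tail x) (Fin.tail y)) : Fin (s.len + 1) → A)
          j.succ := by
  simp only [placeWord, Fin.cons_succ, Function.comp_apply]
  by_cases hj : ∃ l, h l = j
  · obtain ⟨l, rfl⟩ := hj
    simp only [h.injective.eq_iff]
    rw [prod_ite_of_injective (f := fun l => l) (fun _ _ h => h)]
    simp only [exists_eq_left, MixableShuffle.word_apply]
    have hl := s.left_strictMono.injective
    have hr := s.right_strictMono.injective
    by_cases h1 : ∃ i, s.left i = l
    · by_cases h2 : ∃ i, s.right i = l
      · rw [if_pos ⟨h1, h2⟩]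
        obtain ⟨i, rfl⟩ := h1
        obtain ⟨i', hi'⟩ := h2
        rw [prod_ite_of_injective hl, prod_ite_of_injective hl, ← hi',
          prod_ite_of_injective hr, prod_ite_of_injective hr, iotaMap_mul]
        rfl
      · rw [if_neg fun h => h2 h.2]
        obtain ⟨i, rfl⟩ := h1
        push Not at h2
        rw [prod_ite_of_injective hl, prod_ite_of_injective hl, prod_ite_of_notMem _ _ h2,
          prod_ite_of_notMem _ _ h2, one_smul, mul_one, mul_one]
        rfl
    · rw [if_neg fun h => h1 h.1]
      obtain ⟨i, rfl⟩ := (s.left_or_right l).resolve_left h1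
      push Not at h1
      rw [prod_ite_of_injective hr, prod_ite_of_injective hr, prod_ite_of_notMem _ _ h1,
          prod_ite_of_notMem _ _ h1, one_smul, one_mul, one_mul]
      rfl
  · rw [if_neg fun ⟨l, hl, _⟩ => hj ⟨l, hl⟩]
    push Not at hj
    rw [prod_ite_of_notMem _ _ hj, prod_ite_of_notMem _ _ fun i => hj (s.left i),
      prod_ite_of_notMem _ _ fun i => hj (s.right i), one_smul, one_mul]

theorem place_mul {m n N : ℕ} (s : MixableShuffle m n) (h : Fin s.len ↪o Fin N)
    (x : Fin (m + 1) → A) (y : Fin (n + 1) → A) :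
    place lam (h ∘ s.left) (PiTensorProduct.tprod C x) *
        place lam (h ∘ s.right) (PiTensorProduct.tprod C y) =
      lam ^ s.T.card • place lam h (PiTensorProduct.tprod C
        (Fin.cons (x 0 * y 0) (s.word (Fin.tail x) (Fin.tail y)) : Fin (s.len + 1) → A)) := by
  classical
  rw [place_tprod, place_tprod, place_tprod, PiTensorProduct.tprod_mul_tprod]
  let c : Fin (N + 1) → C := Fin.cons 1 fun j =>
    if ∃ l, h l = j ∧ (∃ i, s.left i = l) ∧ ∃ i, s.right i = l then lam else 1
  have hc : ∏ j, c j = lam ^ s.T.card := by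
    rw [Fin.prod_univ_succ]
    simp only [c, Fin.cons_zero, Fin.cons_succ, one_mul]
    rw [Finset.prod_ite, Finset.prod_const_one, mul_one, Finset.prod_const, ← s.card_both,
      ← Finset.card_map h.toEmbedding]
    congr 2
    ext j
    simp only [Finset.mem_filter, Finset.mem_univ, true_and, Finset.mem_map]
    constructor
    · rintro ⟨l, h1, h2⟩
      exact ⟨l, h2, h1⟩
    · rintro ⟨l, h2, h1⟩
      exact ⟨l, h1, h2⟩
  rw [← hc, ← MultilinearMap.map_smul_univ]
  congr 1
  ext1 j
  induction j using Fin.cases with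
  | zero => simp [c, placeWord, inclMap_mul]
  | succ j =>
    rw [Pi.mul_apply, placeWord_mul]
    rfl

/-- The `N`-th component of the embedding. -/
noncomputable def embed (N : ℕ) : Sha C A lam →ₗ[C] TPow C (QExt (A := A) lam) (N + 1) :=
  lift fun m => ∑ f : Fin m ↪o Fin N, place lam f

theorem embed_of (N m : ℕ) (x : TPow C A (m + 1)) :
    embed lam N (of C A lam m x) = ∑ f : Fin m ↪o Fin N, place lam f x := by
  rw [embed, lift_of, LinearMap.sum_apply]

theorem embed_mul (N : ℕ) (x y : Sha C A lam) :
    embed lam N (x * y) = embed lam N x * embed lam N y := by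
  have key : (mulMap C A lam).compr₂ (embed lam N) =
      (LinearMap.mul C _).compl₁₂ (embed lam N) (embed lam N) := by
    refine linearMap_ext fun m a => linearMap_ext fun n b => ?_
    change embed lam N (of C A lam m (PiTensorProduct.tprod C a) *
      of C A lam n (PiTensorProduct.tprod C b)) = embed lam N _ * embed lam N _
    simp only [tprod_mul_tprod, map_sum, map_smul, embed_of]
    rw [Finset.sum_mul_sum, ← Fintype.sum_prod_type',
      ← (Function.Bijective.sum_comp
        ⟨MixableShuffle.split_injective (m := m) (n := n) N, MixableShuffle.split_surjective N⟩ _),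
      Fintype.sum_sigma]
    refine Finset.sum_congr rfl fun s _ => ?_
    rw [Finset.smul_sum]
    refine Finset.sum_congr rfl fun h _ => ?_
    exact (place_mul lam s h a b).symm
  exact DFunLike.congr_fun (DFunLike.congr_fun key x) y

theorem orderEmbedding_eq {m N : ℕ} (h : N ≤ m ∨ m = 0) (f g : Fin m ↪o Fin N) : f = g := by
  rcases h with h | rfl
  · have hN : m = N := le_antisymm (by simpa using Fintype.card_le_of_embedding f.toEmbedding) h
    subst hN
    have hf : Function.Surjective f := Finite.injective_iff_surjective.1 f.injective
    have hg : Function.Surjective g := Finite.injective_iff_surjective.1 g.injective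
    exact DFunLike.coe_injective
      ((f.strictMono.range_inj g.strictMono).1 (hf.range_eq.trans hg.range_eq.symm))
  · ext i
    exact i.elim0

theorem embed_one (N : ℕ) : embed lam N (1 : Sha C A lam) = 1 := by
  have : Subsingleton (Fin 0 ↪o Fin N) := ⟨orderEmbedding_eq (Or.inr rfl)⟩
  rw [one_def, embed_of, Fintype.sum_subsingleton _ (OrderEmbedding.ofIsEmpty), place_tprod,
    PiTensorProduct.one_def]
  congr 1
  ext1 j
  induction j using Fin.cases with
  | zero => rfl
  | succ j => simp [placeWord]

/-- Recovers a component of an element of `Ш_C(A)` from the embedding. -/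
noncomputable def proj (N : ℕ) : TPow C (QExt (A := A) lam) (N + 1) →ₗ[C] TPow C A (N + 1) :=
  PiTensorProduct.map (Fin.cons (reMap lam) fun _ => imMap lam)

theorem proj_embed (N : ℕ) : proj lam N ∘ₗ embed lam N = coeff C A lam N := by
  refine linearMap_ext fun m a => ?_
  rw [LinearMap.comp_apply, embed_of, map_sum]
  simp only [place_tprod, proj, PiTensorProduct.map_tprod]
  have hzero : ∀ f : Fin m ↪o Fin N, ∀ j : Fin N, (∀ i, f i ≠ j) →
      (PiTensorProduct.tprod C fun i => (Fin.cons (reMap lam) fun _ => imMap lam :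
        Fin (N + 1) → (QExt (A := A) lam →ₗ[C] A)) i (placeWord lam f a i)) = 0 := by
    intro f j hj
    refine MultilinearMap.map_coord_zero _ j.succ ?_
    simp only [Fin.cons_succ, placeWord]
    rw [prod_ite_of_notMem _ _ hj]
    rfl
  by_cases hm : m = N
  · subst hm
    have : Subsingleton (Fin m ↪o Fin m) := ⟨orderEmbedding_eq (Or.inl le_rfl)⟩
    rw [coeff_of_self, Fintype.sum_subsingleton _ (OrderIso.refl (Fin m)).toOrderEmbedding]
    congr 1
    ext1 j
    induction j using Fin.cases with
    | zero => rfl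
    | succ j =>
      exact congrArg (imMap lam) (prod_ite_of_injective (f := fun l : Fin m => l)
        Function.injective_id (fun i => iotaMap lam (a i.succ)) j)
  · rw [coeff_of_ne (Ne.symm hm)]
    refine Finset.sum_eq_zero fun f _ => ?_
    have : ¬ Function.Surjective f := fun hs => hm <| by
      simpa using Fintype.card_of_bijective ⟨f.injective, hs⟩
    simp only [Function.Surjective, not_forall, not_exists] at this
    obtain ⟨j, hj⟩ := this
    exact hzero f j hj

theorem embed_injective : Function.Injective
    fun (x : Sha C A lam) (N : ℕ) => embed lam N x := by
  intro x y h
  refine ext_coeff fun N => ?_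
  rw [← proj_embed, LinearMap.comp_apply, LinearMap.comp_apply]
  exact congrArg _ (congrFun h N)

end Embedding

/-- The shuffle Baxter algebra as a commutative ring under the mixed shuffle product. -/
noncomputable instance : CommRing (Sha C A lam) where
  __ := (inferInstance : AddCommGroup (Sha C A lam))
  left_distrib x y z := map_add (mulMap C A lam x) y z
  right_distrib x y z := by simp only [mul_def, map_add, LinearMap.add_apply]
  zero_mul x := by simp only [mul_def, map_zero, LinearMap.zero_apply]
  mul_zero x := map_zero (mulMap C A lam x)
  mul_assoc x y z := embed_injective lam <| funext fun N => by simp only [embed_mul, mul_assoc]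
  one_mul x := embed_injective lam <| funext fun N => by simp only [embed_mul, embed_one, one_mul]
  mul_one x := embed_injective lam <| funext fun N => by simp only [embed_mul, embed_one, mul_one]
  mul_comm x y := embed_injective lam <| funext fun N => by simp only [embed_mul, mul_comm]

theorem exists_eq_sum (x : Sha C A lam) :
    ∃ S : Finset ℕ, x = ∑ n ∈ S, of C A lam n (coeff C A lam n x) := by
  classical
  exact ⟨DFinsupp.support x, (DirectSum.sum_support_of x).symm⟩

theorem coeff_mul_of_of_lt {n p : ℕ} (h : n < p) (x : Sha C A lam) (y : TPow C A (p + 1)) :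
    coeff C A lam n (x * of C A lam p y) = 0 := by
  obtain ⟨S, hS⟩ := exists_eq_sum x
  rw [hS, Finset.sum_mul, map_sum]
  refine Finset.sum_eq_zero fun m _ => ?_
  rw [of_mul_of, map_sum]
  refine Finset.sum_eq_zero fun s _ => ?_
  rw [map_smul, coeff_of_ne (h.trans_le s.le_len_right).ne, smul_zero]

variable (C A lam) in
/-- The ideal `Fil^k Ш_C(A)`, the sum of the `A^{⊗ (n + 1)}` with `n ≥ k`. -/
noncomputable def fil (k : ℕ) : Ideal (Sha C A lam) where
  carrier := {x | ∀ n < k, coeff C A lam n x = 0}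
  add_mem' hx hy n hn := by rw [map_add, hx n hn, hy n hn, add_zero]
  zero_mem' n _ := map_zero _
  smul_mem' c x hx n hn := by
    obtain ⟨S, hS⟩ := exists_eq_sum x
    rw [hS, smul_eq_mul, Finset.mul_sum, map_sum]
    refine Finset.sum_eq_zero fun p _ => ?_
    rcases lt_or_ge p k with hp | hp
    · rw [hx p hp, map_zero, mul_zero, map_zero]
    · exact coeff_mul_of_of_lt (hn.trans_le hp) c _

theorem fil_anti {j k : ℕ} (h : j ≤ k) : fil C A lam k ≤ fil C A lam j :=
  fun _ hx n hn => hx n (hn.trans_le h)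

end Sha

/-- The complete shuffle Baxter algebra, i.e. the inverse limit of the rings
`Ш_C(A) / Fil^k Ш_C(A)`, realized as the ring of compatible families.  (The index `k = 0` only
contributes the zero ring.) -/
def shaHatSubring (C : Type u) (A : Type v) [CommRing C] [CommRing A] [Algebra C A] (lam : C) :
    Subring (∀ k : ℕ, Sha C A lam ⧸ Sha.fil C A lam k) where
  carrier := {x | ∀ (j k : ℕ) (h : j ≤ k), Ideal.Quotient.factor (Sha.fil_anti h) (x k) = x j}
  mul_mem' hx hy j k h := by rw [Pi.mul_apply, map_mul, hx j k h, hy j k h, Pi.mul_apply]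
  one_mem' j k h := by rw [Pi.one_apply, map_one, Pi.one_apply]
  add_mem' hx hy j k h := by rw [Pi.add_apply, map_add, hx j k h, hy j k h, Pi.add_apply]
  zero_mem' j k h := by rw [Pi.zero_apply, map_zero, Pi.zero_apply]
  neg_mem' hx j k h := by rw [Pi.neg_apply, map_neg, hx j k h, Pi.neg_apply]

/-- The completion `Ш̂_C(A)` of the shuffle Baxter algebra of weight `lam`. -/
abbrev ShaHat (C : Type u) (A : Type v) [CommRing C] [CommRing A] [Algebra C A] (lam : C) :
    Type (max u v) :=
  shaHatSubring C A lam

namespace ShaHat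

variable {C : Type u} {A : Type v} [CommRing C] [CommRing A] [Algebra C A] {lam : C}

/-- The infinite sum `∑_n a_n`, `a_n ∈ A^{⊗ (n + 1)}`, in `Ш̂_C(A)`: its residue modulo `Fil^k` is
that of `∑_{n < k} a_n`. -/
noncomputable def series (lam : C) (a : ∀ n : ℕ, TPow C A (n + 1)) : ShaHat C A lam :=
  ⟨fun k => Ideal.Quotient.mk _ (∑ n ∈ Finset.range k, Sha.of C A lam n (a n)), by
    intro j k h
    rw [Ideal.Quotient.factor_mk, Ideal.Quotient.eq, ← Finset.sum_range_add_sum_Ico _ h,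
      add_sub_cancel_left]
    refine sum_mem fun n hn i hi => Sha.coeff_of_ne ?_ _
    exact (hi.trans_le (Finset.mem_Ico.1 hn).1).ne⟩

variable (C A lam) in
/-- The canonical map `Ш_C(A) → Ш̂_C(A)`. -/
noncomputable def ofSha : Sha C A lam →+* ShaHat C A lam :=
  (RingHom.pi fun k => Ideal.Quotient.mk (Sha.fil C A lam k)).codRestrict (shaHatSubring C A lam)
    fun _ _ _ _ => rfl

end ShaHat

/-- The element `1^{⊗ n}` of `A^{⊗ n}`. -/
noncomputable def onePow (C : Type u) (A : Type v) [CommRing C] [CommRing A] [Algebra C A]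
    (n : ℕ) : TPow C A n :=
  PiTensorProduct.tprod C fun _ => 1

/-!
The component of a product of homogeneous tensors in the highest degree comes from the shuffles
that merge nothing. Fix an ordered basis of `A` over `C`, regard `A^{⊗ (n + 1)}` as the free
`A`-module on the basis words of length `n`, and order these words lexicographically. Interleaving
is strictly increasing in each of the two words, so the largest interleaving of the leading words
of `x` and `y` arises from no other pair of words. Its coefficient is the product of the two
leading coefficients times the number of shuffles that produce it, a positive integer, and thus
does not vanish. Applied to top components this shows that `Ш_C(A)` is a domain. In weight `0` only
the shuffles that merge nothing contribute, so the product is graded, and the argument applies to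
lowest components, hence to the completion.

Pairs of an `m`-subset and an `n`-subset of an `N`-set correspond to a mixable shuffle `s` together
with a subset of size `len s`, whence `∑_s (N choose len s) = (N choose m) (N choose n)`. For
`m = 1` this gives `n` shuffles of length `n` and `n + 1` of length `n + 1`, that is
`1^{⊗ 2} 1^{⊗ (n + 1)} = n λ 1^{⊗ (n + 1)} + (n + 1) 1^{⊗ (n + 2)}`. Multiplied by `(-λ)^{-n}`, the
right-hand side becomes a difference of consecutive terms, and `x y` telescopes to `0`.
-/

theorem toLex_lt_of_comp_lt {ι κ I : Type*} [LinearOrder ι] [Preorder κ] [LT I] {e : ι → κ}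
    (he : StrictMono e) {w w' : κ → I} (hoff : ∀ k ∉ Set.range e, w k = w' k)
    (h : toLex (w ∘ e) < toLex (w' ∘ e)) : toLex w < toLex w' := by
  obtain ⟨i, hi, hlt⟩ := h
  refine ⟨e i, fun k hk => ?_, hlt⟩
  by_cases hmem : k ∈ Set.range e
  · obtain ⟨j, rfl⟩ := hmem
    exact hi j (he.lt_iff_lt.1 hk)
  · exact hoff k hmem

theorem card_orderEmbedding_fin (k N : ℕ) : Fintype.card (Fin k ↪o Fin N) = N.choose k := by
  rw [← Nat.card_eq_fintype_card, Nat.card_congr Set.powersetCard.ofFinEmbEquiv,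
    Set.powersetCard.card, Nat.card_fin]

namespace MixableShuffle

variable {m n : ℕ}

section Interleave

variable {I : Type*} (s : MixableShuffle m n)

/-- The positions taken by the letters of the first word. -/
def leftPos (i : Fin m) : Fin (m + n) := s.perm.symm (Fin.castAdd n i)

/-- The positions taken by the letters of the second word. -/
def rightPos (i : Fin n) : Fin (m + n) := s.perm.symm (Fin.natAdd m i)

theorem leftPos_strictMono : StrictMono s.leftPos := s.left_lt

theorem rightPos_strictMono : StrictMono s.rightPos := s.right_lt

theorem mem_range_leftPos_or_mem_range_rightPos (k : Fin (m + n)) :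
    k ∈ Set.range s.leftPos ∨ k ∈ Set.range s.rightPos := by
  obtain ⟨i, rfl⟩ := s.perm.symm.surjective k
  induction i using Fin.addCases with
  | left i => exact .inl ⟨i, rfl⟩
  | right i => exact .inr ⟨i, rfl⟩

/-- The word obtained by shuffling two words according to `s`, without merging any letters. -/
def interleave : (Fin m → I) × (Fin n → I) ≃ (Fin (m + n) → I) :=
  (Fin.appendEquiv m n).trans (s.perm.symm.arrowCongr (Equiv.refl I))

theorem interleave_leftPos (u : Fin m → I) (v : Fin n → I) (i : Fin m) :
    s.interleave (u, v) (s.leftPos i) = u i := by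
  simp [interleave, leftPos, Fin.appendEquiv]

theorem interleave_rightPos (u : Fin m → I) (v : Fin n → I) (i : Fin n) :
    s.interleave (u, v) (s.rightPos i) = v i := by
  simp [interleave, rightPos, Fin.appendEquiv]

theorem interleave_symm_apply (w : Fin (m + n) → I) :
    s.interleave.symm w = (w ∘ s.leftPos, w ∘ s.rightPos) := by
  obtain ⟨⟨u, v⟩, rfl⟩ := s.interleave.surjective w
  rw [Equiv.symm_apply_apply]
  exact Prod.ext (funext fun i => (s.interleave_leftPos u v i).symm)
    (funext fun i => (s.interleave_rightPos u v i).symm)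

variable [LinearOrder I]

theorem interleave_lt_interleave_left {u u' : Fin m → I} (v : Fin n → I)
    (h : toLex u < toLex u') : toLex (s.interleave (u, v)) < toLex (s.interleave (u', v)) := by
  refine toLex_lt_of_comp_lt s.leftPos_strictMono (fun k hk => ?_) ?_
  · obtain ⟨j, rfl⟩ := (s.mem_range_leftPos_or_mem_range_rightPos k).resolve_left hk
    simp only [interleave_rightPos]
  · simpa only [Function.comp_def, interleave_leftPos] using h

theorem interleave_lt_interleave_right (u : Fin m → I) {v v' : Fin n → I}
    (h : toLex v < toLex v') : toLex (s.interleave (u, v)) < toLex (s.interleave (u, v')) := by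
  refine toLex_lt_of_comp_lt s.rightPos_strictMono (fun k hk => ?_) ?_
  · obtain ⟨i, rfl⟩ := (s.mem_range_leftPos_or_mem_range_rightPos k).resolve_right hk
    simp only [interleave_leftPos]
  · simpa only [Function.comp_def, interleave_rightPos] using h

theorem interleave_strictMono : StrictMono
    fun p : Lex (Fin m → I) × Lex (Fin n → I) => toLex (s.interleave (ofLex p.1, ofLex p.2)) := by
  rintro ⟨u, v⟩ ⟨u', v'⟩ h
  obtain ⟨hu, hv⟩ | ⟨hu, hv⟩ := Prod.lt_iff.1 h
  · have left_lt := s.interleave_lt_interleave_left (ofLex v) hu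
    rcases hv.eq_or_lt with rfl | hv
    · exact left_lt
    · exact left_lt.trans (s.interleave_lt_interleave_right (ofLex u') hv)
  · have right_lt := s.interleave_lt_interleave_right (ofLex u) hv
    rcases hu.eq_or_lt with rfl | hu
    · exact right_lt
    · exact right_lt.trans (s.interleave_lt_interleave_left (ofLex v') hu)

/-- The shuffle that writes the second word after the first one. -/
def concat (m n : ℕ) : MixableShuffle m n where
  perm := Equiv.refl _
  T := ∅
  left_lt _ _ h := h
  right_lt _ _ h := Fin.natAdd_lt_natAdd_iff m |>.2 h
  admissible _ hk := absurd hk (Finset.notMem_empty _)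

end Interleave

section NoMerging

variable {s : MixableShuffle m n}

theorem len_of_T_eq_empty (hs : s.T = ∅) : s.len = m + n := by
  simp [len, hs]

theorem len_lt_of_T_ne_empty (hs : s.T ≠ ∅) : s.len < m + n := by
  have := s.card_T_le
  have := Finset.card_pos.2 (Finset.nonempty_iff_ne_empty.2 hs)
  lia

theorem block_eq_cast (hs : s.T = ∅) : s.block = Fin.cast (len_of_T_eq_empty hs).symm := by
  ext k
  have : (Finset.univ.filter fun t => t < k ∧ t ∉ s.T) = Finset.Iio k := by
    ext t
    simp [hs]
  simp [block, this]

theorem block_bijective (hs : s.T = ∅) : Function.Bijective s.block := by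
  rw [block_eq_cast hs]
  exact (finCongr (len_of_T_eq_empty hs).symm).bijective

theorem cast_comp_left (hs : s.T = ∅) : Fin.cast (len_of_T_eq_empty hs) ∘ s.left = s.leftPos :=
  funext fun i => by rw [Function.comp_apply, left, block_eq_cast hs]; rfl

theorem cast_comp_right (hs : s.T = ∅) : Fin.cast (len_of_T_eq_empty hs) ∘ s.right = s.rightPos :=
  funext fun i => by rw [Function.comp_apply, right, block_eq_cast hs]; rfl

theorem word_block {M : Type*} [CommMonoid M] (hs : s.T = ∅) (x : Fin m → M) (y : Fin n → M)
    (k : Fin (m + n)) : s.word x y (s.block k) = Fin.append x y (s.perm k) := by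
  simp only [word, (block_bijective hs).injective.eq_iff, Finset.filter_eq', Finset.mem_univ,
    if_true, Finset.prod_singleton]

theorem word_left {M : Type*} [CommMonoid M] (hs : s.T = ∅) (x : Fin m → M) (y : Fin n → M)
    (i : Fin m) : s.word x y (s.left i) = x i := by
  rw [left, word_block hs, Equiv.apply_symm_apply, Fin.append_left]

theorem word_right {M : Type*} [CommMonoid M] (hs : s.T = ∅) (x : Fin m → M) (y : Fin n → M)
    (i : Fin n) : s.word x y (s.right i) = y i := by
  rw [right, word_block hs, Equiv.apply_symm_apply, Fin.append_right]

theorem prod_univ_factors {M : Type*} [CommMonoid M] (hs : s.T = ∅) (f : Fin s.len → M) :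
    ∏ j, f j = (∏ i, f (s.left i)) * ∏ i, f (s.right i) := by
  rw [← (block_bijective hs).prod_comp, ← Equiv.prod_comp s.perm.symm, Fin.prod_univ_add]
  rfl

end NoMerging

section Counting

theorem len_le (s : MixableShuffle m n) : s.len ≤ m + n := Nat.sub_le _ _

theorem card_T_eq (s : MixableShuffle m n) : s.T.card = m + n - s.len :=
  (Nat.sub_sub_self s.card_T_le).symm

theorem sum_choose_len (m n N : ℕ) :
    ∑ s : MixableShuffle m n, N.choose s.len = N.choose m * N.choose n := by
  simpa [Fintype.card_sigma, card_orderEmbedding_fin] using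
    Fintype.card_of_bijective ⟨split_injective (m := m) (n := n) N, split_surjective N⟩

theorem len_eq_or_eq_succ (s : MixableShuffle 1 n) : s.len = n ∨ s.len = n + 1 := by
  have := s.le_len_right
  have := s.len_le
  lia

theorem sum_comp_len {M : Type*} [AddCommMonoid M] (n : ℕ) (f : ℕ → M) :
    ∑ s : MixableShuffle 1 n, f s.len =
      (Finset.univ.filter fun s : MixableShuffle 1 n => s.len = n).card • f n +
        (Finset.univ.filter fun s : MixableShuffle 1 n => s.len = n + 1).card • f (n + 1) := by
  have split_by_len (s : MixableShuffle 1 n) :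
      f s.len = (if s.len = n then f n else 0) + if s.len = n + 1 then f (n + 1) else 0 := by
    rcases s.len_eq_or_eq_succ with h | h <;> simp [h]
  simp only [split_by_len, Finset.sum_add_distrib, ← Finset.sum_filter, Finset.sum_const]

theorem card_len_eq (n : ℕ) :
    (Finset.univ.filter fun s : MixableShuffle 1 n => s.len = n).card = n := by
  simpa [sum_comp_len n n.choose] using sum_choose_len 1 n n

theorem card_len_eq_succ (n : ℕ) :
    (Finset.univ.filter fun s : MixableShuffle 1 n => s.len = n + 1).card = n + 1 := by
  have h := sum_choose_len 1 n (n + 1)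
  simp only [sum_comp_len n (n + 1).choose, card_len_eq, Nat.choose_succ_self_right,
    Nat.choose_self, Nat.choose_one_right, smul_eq_mul, mul_one] at h
  linarith

end Counting

end MixableShuffle

namespace TPow

open Module

variable {C : Type u} {A : Type v} [CommRing C] [CommRing A] [Algebra C A]
variable {I : Type*} (b : Basis I C A) {n : ℕ}

/-- The coefficient of the basis word `w` under the identification of `A ⊗ A^{⊗ n}` with the free
`A`-module on the words of length `n` in the basis `b`. -/
noncomputable def wordCoord (w : Fin n → I) : TPow C A (n + 1) →ₗ[C] A :=
  PiTensorProduct.lift ((MultilinearMap.mkPiAlgebra C (Fin (n + 1)) A).compLinearMap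
    (Fin.cons LinearMap.id fun i => Algebra.linearMap C A ∘ₗ b.coord (w i)))

theorem wordCoord_tprod (w : Fin n → I) (a : Fin (n + 1) → A) :
    wordCoord b w (PiTensorProduct.tprod C a) =
      a 0 * ∏ i, algebraMap C A (b.repr (a i.succ) (w i)) := by
  simp [wordCoord, Fin.prod_univ_succ]

theorem repr_wordCoord (w : Fin n → I) (x : TPow C A (n + 1)) (i : I) :
    b.repr (wordCoord b w x) i =
      (Basis.piTensorProduct fun _ => b).repr x (Fin.cons i w : Fin (n + 1) → I) := by
  suffices b.coord i ∘ₗ wordCoord b w =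
      (Basis.piTensorProduct fun _ => b).coord (Fin.cons i w : Fin (n + 1) → I) from
    DFunLike.congr_fun this x
  refine PiTensorProduct.ext (MultilinearMap.ext fun a => ?_)
  simp only [LinearMap.compMultilinearMap_apply, LinearMap.comp_apply, wordCoord_tprod,
    Basis.coord_apply, Basis.piTensorProduct_repr_tprod_apply, Fin.prod_univ_succ, Fin.cons_zero,
    Fin.cons_succ]
  rw [← map_prod, mul_comm, ← Algebra.smul_def, map_smul, Finsupp.smul_apply, smul_eq_mul,
    mul_comm]

theorem wordCoord_ne_zero_iff {w : Fin n → I} {x : TPow C A (n + 1)} :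
    wordCoord b w x ≠ 0 ↔
      ∃ i, (Basis.piTensorProduct fun _ => b).repr x (Fin.cons i w : Fin (n + 1) → I) ≠ 0 := by
  rw [← b.repr.map_ne_zero_iff, Finsupp.ne_iff]
  simp only [repr_wordCoord, Finsupp.zero_apply]

theorem exists_wordCoord_ne_zero {x : TPow C A (n + 1)} (hx : x ≠ 0) :
    ∃ w : Fin n → I, wordCoord b w x ≠ 0 := by
  rw [← (Basis.piTensorProduct fun _ => b).repr.map_ne_zero_iff, Finsupp.ne_iff] at hx
  obtain ⟨p, hp⟩ := hx
  exact ⟨Fin.tail p, (wordCoord_ne_zero_iff b).2 ⟨p 0, by rwa [Fin.cons_self_tail]⟩⟩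

theorem finite_wordCoord_ne_zero (x : TPow C A (n + 1)) :
    {w : Fin n → I | wordCoord b w x ≠ 0}.Finite := by
  refine (((Basis.piTensorProduct fun _ => b).repr x).support.finite_toSet.image
    Fin.tail).subset fun w hw => ?_
  obtain ⟨i, hi⟩ := (wordCoord_ne_zero_iff b).1 hw
  exact ⟨Fin.cons i w, Finsupp.mem_support_iff.2 hi, Fin.tail_cons _ _⟩

/-- `w` is the lexicographically largest basis word occurring in `x`, where the factor of index `0`
counts as a coefficient. -/
def IsLeadingWord [LinearOrder I] (w : Fin n → I) (x : TPow C A (n + 1)) : Prop :=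
  wordCoord b w x ≠ 0 ∧ ∀ w' : Fin n → I, wordCoord b w' x ≠ 0 → toLex w' ≤ toLex w

theorem exists_isLeadingWord [LinearOrder I] {x : TPow C A (n + 1)} (hx : x ≠ 0) :
    ∃ w : Fin n → I, IsLeadingWord b w x :=
  Set.exists_max_image _ toLex (finite_wordCoord_ne_zero b x) (exists_wordCoord_ne_zero b hx)

end TPow

namespace MixableShuffle

open Module

variable {C : Type u} {A : Type v} [CommRing C] [CommRing A] [Algebra C A]
variable {I : Type*} (b : Basis I C A) {m n : ℕ} {s : MixableShuffle m n}

theorem wordCoord_prodTerm (hs : s.T = ∅) (w : Fin s.len → I)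
    (x : TPow C A (m + 1)) (y : TPow C A (n + 1)) :
    TPow.wordCoord b w (s.prodTerm x y) =
      TPow.wordCoord b (w ∘ s.left) x * TPow.wordCoord b (w ∘ s.right) y := by
  suffices s.prodTerm.compr₂ (TPow.wordCoord b w) =
      (LinearMap.mul C A).compl₁₂ (TPow.wordCoord b (w ∘ s.left))
        (TPow.wordCoord b (w ∘ s.right)) from
    DFunLike.congr_fun (DFunLike.congr_fun this x) y
  refine PiTensorProduct.ext (MultilinearMap.ext fun x => PiTensorProduct.ext
    (MultilinearMap.ext fun y => ?_))
  simp only [LinearMap.compMultilinearMap_apply, LinearMap.compr₂_apply,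
    LinearMap.compl₁₂_apply, LinearMap.mul_apply', prodTerm_tprod, TPow.wordCoord_tprod,
    Fin.cons_zero, Fin.cons_succ, prod_univ_factors hs, word_left hs, word_right hs,
    Function.comp_apply, Fin.tail]
  ring

theorem wordCoord_interleave_symm_mul_eq_ite [LinearOrder I] {u : Fin m → I} {v : Fin n → I}
    {x : TPow C A (m + 1)} {y : TPow C A (n + 1)} (hu : TPow.IsLeadingWord b u x)
    (hv : TPow.IsLeadingWord b v y) {w : Fin (m + n) → I}
    (hw : toLex (s.interleave (u, v)) ≤ toLex w) :
    TPow.wordCoord b (s.interleave.symm w).1 x * TPow.wordCoord b (s.interleave.symm w).2 y =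
      if s.interleave (u, v) = w then TPow.wordCoord b u x * TPow.wordCoord b v y else 0 := by
  split_ifs with h
  · rw [← h, Equiv.symm_apply_apply]
  · by_contra hne
    obtain ⟨⟨u', v'⟩, rfl⟩ := s.interleave.surjective w
    rw [Equiv.symm_apply_apply] at hne
    have le : (toLex u', toLex v') ≤ (toLex u, toLex v) :=
      ⟨hu.2 u' (left_ne_zero_of_mul hne), hv.2 v' (right_ne_zero_of_mul hne)⟩
    have eq := eq_of_le_of_not_lt le fun lt => hw.not_gt (s.interleave_strictMono lt)
    simp only [Prod.mk.injEq, toLex_inj] at eq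
    exact h (by rw [eq.1, eq.2])

end MixableShuffle

namespace Sha

open Module

variable {C : Type u} {A : Type v} [CommRing C] [CommRing A] [Algebra C A] {lam : C}

section TopComponent

variable {I : Type*} (b : Basis I C A) {m n : ℕ}

theorem wordCoord_coeff_of {k N : ℕ} (h : k = N) (w : Fin N → I) (z : TPow C A (k + 1)) :
    TPow.wordCoord b w (coeff C A lam N (of C A lam k z)) =
      TPow.wordCoord b (w ∘ Fin.cast h) z := by
  subst h
  rw [coeff_of_self]
  rfl

theorem wordCoord_coeff_add_of_mul_of (x : TPow C A (m + 1)) (y : TPow C A (n + 1))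
    (w : Fin (m + n) → I) :
    TPow.wordCoord b w (coeff C A lam (m + n) (of C A lam m x * of C A lam n y)) =
      ∑ s : MixableShuffle m n with s.T = ∅,
        TPow.wordCoord b (s.interleave.symm w).1 x *
          TPow.wordCoord b (s.interleave.symm w).2 y := by
  simp only [of_mul_of, map_sum, map_smul, Finset.sum_filter]
  refine Finset.sum_congr rfl fun s _ => ?_
  split_ifs with hs
  · rw [wordCoord_coeff_of b (MixableShuffle.len_of_T_eq_empty hs),
      MixableShuffle.wordCoord_prodTerm b hs, hs, Finset.card_empty, pow_zero, one_smul,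
      MixableShuffle.interleave_symm_apply, Function.comp_assoc, Function.comp_assoc,
      MixableShuffle.cast_comp_left hs, MixableShuffle.cast_comp_right hs]
  · rw [coeff_of_ne (MixableShuffle.len_lt_of_T_ne_empty hs).ne', map_zero, smul_zero]

theorem exists_wordCoord_coeff_add_of_mul_of [LinearOrder I] {u : Fin m → I} {v : Fin n → I}
    {x : TPow C A (m + 1)} {y : TPow C A (n + 1)} (hu : TPow.IsLeadingWord b u x)
    (hv : TPow.IsLeadingWord b v y) :
    ∃ w : Fin (m + n) → I, ∃ k ≠ 0,
      TPow.wordCoord b w (coeff C A lam (m + n) (of C A lam m x * of C A lam n y)) =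
        k • (TPow.wordCoord b u x * TPow.wordCoord b v y) := by
  let shuffles := Finset.univ.filter fun s : MixableShuffle m n => s.T = ∅
  obtain ⟨s₀, hs₀, hmax⟩ := shuffles.exists_max_image (fun s => toLex (s.interleave (u, v)))
    ⟨MixableShuffle.concat m n, Finset.mem_filter.2 ⟨Finset.mem_univ _, rfl⟩⟩
  have coord_eq : TPow.wordCoord b (s₀.interleave (u, v))
      (coeff C A lam (m + n) (of C A lam m x * of C A lam n y)) =
        (shuffles.filter fun s => s.interleave (u, v) = s₀.interleave (u, v)).card •
          (TPow.wordCoord b u x * TPow.wordCoord b v y) := by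
    rw [wordCoord_coeff_add_of_mul_of, Finset.sum_congr rfl fun s hs =>
      MixableShuffle.wordCoord_interleave_symm_mul_eq_ite b hu hv (hmax s hs), ← Finset.sum_filter,
      Finset.sum_const]
  refine ⟨_, _, ?_, coord_eq⟩
  exact Finset.card_ne_zero.2 ⟨s₀, Finset.mem_filter.2 ⟨hs₀, rfl⟩⟩

end TopComponent

theorem coeff_add_of_mul_of_ne_zero [Module.Free C A] [IsDomain A] [CharZero A] {m n : ℕ}
    {x : TPow C A (m + 1)} {y : TPow C A (n + 1)} (hx : x ≠ 0) (hy : y ≠ 0) :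
    coeff C A lam (m + n) (of C A lam m x * of C A lam n y) ≠ 0 := by
  classical
  let b := Module.Free.chooseBasis C A
  let : LinearOrder (Module.Free.ChooseBasisIndex C A) := linearOrderOfSTO WellOrderingRel
  obtain ⟨u, hu⟩ := TPow.exists_isLeadingWord b hx
  obtain ⟨v, hv⟩ := TPow.exists_isLeadingWord b hy
  obtain ⟨w, k, hk, h⟩ := exists_wordCoord_coeff_add_of_mul_of (lam := lam) b hu hv
  intro h0
  rw [h0, map_zero] at h
  exact smul_ne_zero hk (mul_ne_zero hu.1 hv.1) h.symm

theorem coeff_of_mul_of_of_add_lt {m n N : ℕ} (h : m + n < N) (x : TPow C A (m + 1))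
    (y : TPow C A (n + 1)) : coeff C A lam N (of C A lam m x * of C A lam n y) = 0 := by
  rw [of_mul_of, map_sum]
  refine Finset.sum_eq_zero fun s _ => ?_
  rw [map_smul, coeff_of_ne (s.len_le.trans_lt h).ne', smul_zero]

theorem coeff_of_mul_of_weight_zero {m n N : ℕ} (h : N ≠ m + n) (x : TPow C A (m + 1))
    (y : TPow C A (n + 1)) : coeff C A 0 N (of C A 0 m x * of C A 0 n y) = 0 := by
  rw [of_mul_of, map_sum]
  refine Finset.sum_eq_zero fun s _ => ?_
  by_cases hs : s.T = ∅
  · rw [map_smul, coeff_of_ne (by rwa [MixableShuffle.len_of_T_eq_empty hs]), smul_zero]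
  · rw [zero_pow (Finset.card_ne_zero.2 (Finset.nonempty_iff_ne_empty.2 hs)), zero_smul, map_zero]

theorem finite_coeff_ne_zero (x : Sha C A lam) : {n | coeff C A lam n x ≠ 0}.Finite :=
  DFinsupp.finite_support x

theorem sum_of_coeff {x : Sha C A lam} {S : Finset ℕ} (hS : ∀ n, coeff C A lam n x ≠ 0 → n ∈ S) :
    ∑ n ∈ S, of C A lam n (coeff C A lam n x) = x := by
  refine ext_coeff fun k => ?_
  rw [map_sum, Finset.sum_eq_single k fun n _ hn => coeff_of_ne hn.symm _, coeff_of_self]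
  intro hk
  rw [coeff_of_self, not_not.1 fun h => hk (hS k h)]

theorem coeff_mul_eq_single {x y : Sha C A lam} {m n N : ℕ}
    (h : ∀ k l, (k, l) ≠ (m, n) → coeff C A lam k x ≠ 0 → coeff C A lam l y ≠ 0 →
      coeff C A lam N (of C A lam k (coeff C A lam k x) * of C A lam l (coeff C A lam l y)) = 0) :
    coeff C A lam N (x * y) =
      coeff C A lam N (of C A lam m (coeff C A lam m x) * of C A lam n (coeff C A lam n y)) := by
  let S := insert m (finite_coeff_ne_zero x).toFinset
  let S' := insert n (finite_coeff_ne_zero y).toFinset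
  have hx : ∑ k ∈ S, of C A lam k (coeff C A lam k x) = x :=
    sum_of_coeff fun k hk => Finset.mem_insert_of_mem ((Set.Finite.mem_toFinset _).2 hk)
  have hy : ∑ l ∈ S', of C A lam l (coeff C A lam l y) = y :=
    sum_of_coeff fun l hl => Finset.mem_insert_of_mem ((Set.Finite.mem_toFinset _).2 hl)
  conv_lhs => rw [← hx, ← hy]
  rw [Finset.sum_mul_sum, ← Finset.sum_product', map_sum]
  refine Finset.sum_eq_single_of_mem (m, n)
    (Finset.mk_mem_product (Finset.mem_insert_self _ _) (Finset.mem_insert_self _ _)) ?_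
  rintro ⟨k, l⟩ - hkl
  by_cases hk : coeff C A lam k x = 0
  · simp only [hk, map_zero, zero_mul]
  by_cases hl : coeff C A lam l y = 0
  · simp only [hl, map_zero, mul_zero]
  exact h k l hkl hk hl

theorem exists_coeff_ne_zero {x : Sha C A lam} (hx : x ≠ 0) : ∃ n, coeff C A lam n x ≠ 0 := by
  by_contra! h
  exact hx (ext_coeff fun k => by rw [h, map_zero])

theorem exists_top_coeff {x : Sha C A lam} (hx : x ≠ 0) :
    ∃ m, coeff C A lam m x ≠ 0 ∧ ∀ k, coeff C A lam k x ≠ 0 → k ≤ m :=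
  Set.exists_max_image _ id (finite_coeff_ne_zero x) (exists_coeff_ne_zero hx)

theorem exists_mem_fil_coeff_ne_zero {x : Sha C A lam} {j : ℕ} (hx : x ∉ fil C A lam j) :
    ∃ m < j, x ∈ fil C A lam m ∧ coeff C A lam m x ≠ 0 := by
  classical
  have exists_ne : ∃ m, coeff C A lam m x ≠ 0 := by
    by_contra! h
    exact hx fun n _ => h n
  refine ⟨Nat.find exists_ne, ?_, fun n hn => not_not.1 (Nat.find_min exists_ne hn),
    Nat.find_spec exists_ne⟩
  by_contra! hj
  exact hx (fil_anti hj fun n hn => not_not.1 (Nat.find_min exists_ne hn))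

theorem le_of_mem_fil {x : Sha C A lam} {k m : ℕ} (hx : x ∈ fil C A lam m)
    (hk : coeff C A lam k x ≠ 0) : m ≤ k :=
  not_lt.1 fun h => hk (hx k h)

section NoZeroDivisors

variable [Module.Free C A] [IsDomain A] [CharZero A]

instance noZeroDivisors : NoZeroDivisors (Sha C A lam) where
  eq_zero_or_eq_zero_of_mul_eq_zero {x y} hxy := by
    by_contra! ⟨hx, hy⟩
    obtain ⟨m, hm, m_top⟩ := exists_top_coeff hx
    obtain ⟨n, hn, n_top⟩ := exists_top_coeff hy
    refine coeff_add_of_mul_of_ne_zero (lam := lam) hm hn ?_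
    rw [← coeff_mul_eq_single, hxy, map_zero]
    intro k l hkl hk hl
    have := m_top k hk
    have := n_top l hl
    exact coeff_of_mul_of_of_add_lt (by grind) _ _

theorem mul_notMem_fil {x y : Sha C A 0} {j k : ℕ} (hx : x ∉ fil C A 0 j)
    (hy : y ∉ fil C A 0 k) : x * y ∉ fil C A 0 (j + k) := by
  obtain ⟨m, hmj, m_low, hm⟩ := exists_mem_fil_coeff_ne_zero hx
  obtain ⟨n, hnk, n_low, hn⟩ := exists_mem_fil_coeff_ne_zero hy
  intro h
  refine coeff_add_of_mul_of_ne_zero (lam := 0) hm hn ?_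
  rw [← coeff_mul_eq_single, h (m + n) (by lia)]
  intro p q hpq hp hq
  have := le_of_mem_fil m_low hp
  have := le_of_mem_fil n_low hq
  exact coeff_of_mul_of_weight_zero (by grind) _ _

end NoZeroDivisors

end Sha

theorem onePow_ne_zero {C : Type u} {A : Type v} [CommRing C] [CommRing A] [Algebra C A]
    [Nontrivial A] (n : ℕ) : onePow C A n ≠ 0 := by
  have lift_onePow : PiTensorProduct.lift (MultilinearMap.mkPiAlgebra C (Fin n) A)
      (onePow C A n) = 1 := by
    simp [onePow]
  intro h
  rw [h, map_zero] at lift_onePow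
  exact zero_ne_one lift_onePow

theorem MixableShuffle.prodTerm_onePow {C : Type u} {A : Type v} [CommRing C] [CommRing A]
    [Algebra C A] {m n : ℕ} (s : MixableShuffle m n) :
    s.prodTerm (onePow C A (m + 1)) (onePow C A (n + 1)) = onePow C A (s.len + 1) := by
  have word_one : s.word (fun _ => (1 : A)) (fun _ => 1) = fun _ => 1 := by
    ext j
    simp [word_apply]
  rw [onePow, onePow, prodTerm_tprod, onePow, mul_one]
  congr 1
  ext j
  induction j using Fin.cases with
  | zero => rfl
  | succ j => exact congrFun word_one j

namespace Sha

variable {C : Type u} {A : Type v} [CommRing C] [CommRing A] [Algebra C A] {lam : C}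

theorem of_injective (n : ℕ) : Function.Injective (of C A lam n) :=
  Function.LeftInverse.injective (coeff_of_self n)

instance nontrivial [Nontrivial A] : Nontrivial (Sha C A lam) :=
  ⟨1, 0, (map_ne_zero_iff _ (of_injective 0)).2 (onePow_ne_zero (C := C) (A := A) 1)⟩

theorem of_onePow_mul_of_onePow (m n : ℕ) :
    of C A lam m (onePow C A (m + 1)) * of C A lam n (onePow C A (n + 1)) =
      ∑ s : MixableShuffle m n, lam ^ s.T.card • of C A lam s.len (onePow C A (s.len + 1)) := by
  simp only [of_mul_of, MixableShuffle.prodTerm_onePow]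

theorem of_one_onePow_mul_of_onePow (n : ℕ) :
    of C A lam 1 (onePow C A 2) * of C A lam n (onePow C A (n + 1)) =
      n • lam • of C A lam n (onePow C A (n + 1)) +
        (n + 1) • of C A lam (n + 1) (onePow C A (n + 2)) := by
  rw [of_onePow_mul_of_onePow]
  simp only [MixableShuffle.card_T_eq]
  rw [MixableShuffle.sum_comp_len n fun k => lam ^ (1 + n - k) • of C A lam k (onePow C A (k + 1)),
    MixableShuffle.card_len_eq, MixableShuffle.card_len_eq_succ, Nat.add_sub_cancel, pow_one,
    Nat.sub_eq_zero_of_le (Nat.add_comm 1 n).le, pow_zero, one_smul]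

instance smulCommClass : SMulCommClass C (Sha C A lam) (Sha C A lam) :=
  ⟨fun c x y => ((mulMap C A lam x).map_smul c y).symm⟩

end Sha

namespace ShaHat

variable {C : Type u} {A : Type v} [CommRing C] [CommRing A] [Algebra C A] {lam : C}

theorem ofSha_injective : Function.Injective (ofSha C A lam) := by
  rw [injective_iff_map_eq_zero]
  intro x hx
  have mem_fil (k : ℕ) : x ∈ Sha.fil C A lam k :=
    Ideal.Quotient.eq_zero_iff_mem.1 (congrFun (congrArg Subtype.val hx) k)
  exact Sha.ext_coeff fun n => (mem_fil (n + 1) n n.lt_succ_self).trans (map_zero _).symm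

theorem series_ne_zero {a : ∀ n : ℕ, TPow C A (n + 1)} {n : ℕ} (ha : a n ≠ 0) :
    series lam a ≠ 0 := by
  intro h
  have sum_mem : ∑ i ∈ Finset.range (n + 1), Sha.of C A lam i (a i) ∈ Sha.fil C A lam (n + 1) :=
    Ideal.Quotient.eq_zero_iff_mem.1 (congrFun (congrArg Subtype.val h) (n + 1))
  have coeff_eq := sum_mem n n.lt_succ_self
  rw [map_sum, Finset.sum_eq_single_of_mem n (Finset.self_mem_range_succ n)
    fun i _ hi => Sha.coeff_of_ne hi.symm _, Sha.coeff_of_self] at coeff_eq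
  exact ha coeff_eq

theorem ofSha_mul_series_eq_zero {μ : C} (hμ : -lam * μ = 1) :
    ofSha C A lam (Sha.of C A lam 1 (onePow C A 2)) *
      series lam (fun n => μ ^ n • onePow C A (n + 1)) = 0 := by
  let f (n : ℕ) : Sha C A lam := (n * lam * μ ^ n) • Sha.of C A lam n (onePow C A (n + 1))
  have mul_eq_sub (n : ℕ) : Sha.of C A lam 1 (onePow C A 2) *
      Sha.of C A lam n (μ ^ n • onePow C A (n + 1)) = f n - f (n + 1) := by
    have coeff_eq : ((n + 1 : ℕ) : C) * lam * μ ^ (n + 1) = -((n + 1 : ℕ) * μ ^ n) := by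
      linear_combination (-((n + 1 : ℕ) * μ ^ n)) * hμ
    simp only [f, coeff_eq]
    rw [map_smul, mul_smul_comm, Sha.of_one_onePow_mul_of_onePow]
    module
  refine Subtype.ext (funext fun k => Ideal.Quotient.eq_zero_iff_mem.2 (?_ :
    Sha.of C A lam 1 (onePow C A 2) * ∑ n ∈ Finset.range k,
      Sha.of C A lam n (μ ^ n • onePow C A (n + 1)) ∈ Sha.fil C A lam k))
  have partial_eq : Sha.of C A lam 1 (onePow C A 2) * ∑ n ∈ Finset.range k,
      Sha.of C A lam n (μ ^ n • onePow C A (n + 1)) = - f k := by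
    rw [Finset.mul_sum, Finset.sum_congr rfl fun n _ => mul_eq_sub n, Finset.sum_range_sub']
    simp [f]
  rw [partial_eq]
  exact neg_mem fun i hi => by rw [map_smul, Sha.coeff_of_ne hi.ne, smul_zero]

theorem exists_notMem_fil {x : ShaHat C A lam} (hx : x ≠ 0) :
    ∃ j, ∀ {k} {X : Sha C A lam}, j ≤ k → Ideal.Quotient.mk (Sha.fil C A lam k) X = x.1 k →
      X ∉ Sha.fil C A lam j := by
  obtain ⟨j, hj⟩ : ∃ j, x.1 j ≠ 0 := by
    by_contra! h
    exact hx (Subtype.ext (funext h))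
  refine ⟨j, fun {k X} hjk hX hmem => hj ?_⟩
  rw [← x.2 j k hjk, ← hX, Ideal.Quotient.factor_mk, Ideal.Quotient.eq_zero_iff_mem.2 hmem]

section WeightZero

variable [Module.Free C A] [IsDomain A] [CharZero A]

instance noZeroDivisors_weight_zero : NoZeroDivisors (ShaHat C A (0 : C)) where
  eq_zero_or_eq_zero_of_mul_eq_zero {x y} hxy := by
    by_contra! ⟨hx, hy⟩
    obtain ⟨j, hj⟩ := exists_notMem_fil hx
    obtain ⟨k, hk⟩ := exists_notMem_fil hy
    obtain ⟨X, hX⟩ := Ideal.Quotient.mk_surjective (x.1 (j + k))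
    obtain ⟨Y, hY⟩ := Ideal.Quotient.mk_surjective (y.1 (j + k))
    refine Sha.mul_notMem_fil (hj (j.le_add_right k) hX) (hk (k.le_add_left j) hY) ?_
    rw [← Ideal.Quotient.eq_zero_iff_mem, map_mul, hX, hY]
    exact congrFun (congrArg Subtype.val hxy) (j + k)

end WeightZero

end ShaHat

theorem mainTheorem4_general {C : Type u} {A : Type v} [CommRing C] [CommRing A] [IsDomain A]
    [CharZero A] [Algebra C A] [Module.Free C A] :
    (∀ lam : C, IsDomain (Sha C A lam)) ∧
    (∀ lam : C, lam = 0 ∨ IsUnit lam → (IsDomain (ShaHat C A lam) ↔ lam = 0)) ∧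
    (∀ lam μ : C, -lam * μ = 1 →
      ShaHat.ofSha C A lam (Sha.of C A lam 1 (onePow C A 2)) ≠ 0 ∧
      ShaHat.series lam (fun n => μ ^ n • onePow C A (n + 1)) ≠ 0 ∧
      ShaHat.ofSha C A lam (Sha.of C A lam 1 (onePow C A 2)) *
        ShaHat.series lam (fun n => μ ^ n • onePow C A (n + 1)) = 0) := by
  have x_ne_zero (lam : C) : ShaHat.ofSha C A lam (Sha.of C A lam 1 (onePow C A 2)) ≠ 0 :=
    (map_ne_zero_iff _ ShaHat.ofSha_injective).2
      ((map_ne_zero_iff _ (Sha.of_injective 1)).2 (onePow_ne_zero 2))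
  have y_ne_zero (lam μ : C) : ShaHat.series lam (fun n => μ ^ n • onePow C A (n + 1)) ≠ 0 :=
    ShaHat.series_ne_zero (n := 0) (by simpa using onePow_ne_zero 1)
  refine ⟨fun _ => NoZeroDivisors.to_isDomain _, fun lam hlam => ⟨fun _ => ?_, ?_⟩,
    fun lam μ hμ => ⟨x_ne_zero lam, y_ne_zero lam μ, ShaHat.ofSha_mul_series_eq_zero hμ⟩⟩
  · refine hlam.resolve_right fun hunit => ?_
    obtain ⟨μ, hμ⟩ := hunit.neg.exists_right_inv
    exact mul_ne_zero (x_ne_zero lam) (y_ne_zero lam μ) (ShaHat.ofSha_mul_series_eq_zero hμ)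
  · rintro rfl
    have := (ShaHat.ofSha_injective (C := C) (A := A) (lam := 0)).nontrivial
    exact NoZeroDivisors.to_isDomain _

theorem mainTheorem4 {C : Type u} {A : Type v} [Field C] [CharZero C] [CommRing A] [IsDomain A]
    [Algebra C A] :
    (∀ lam : C, IsDomain (Sha C A lam)) ∧
    (∀ lam : C, IsDomain (ShaHat C A lam) ↔ lam = 0) ∧
    (∀ lam : C, lam ≠ 0 →
      ShaHat.ofSha C A lam (Sha.of C A lam 1 (onePow C A 2)) ≠ 0 ∧
      ShaHat.series lam (fun n => (-lam)⁻¹ ^ n • onePow C A (n + 1)) ≠ 0 ∧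
      ShaHat.ofSha C A lam (Sha.of C A lam 1 (onePow C A 2)) *
        ShaHat.series lam (fun n => (-lam)⁻¹ ^ n • onePow C A (n + 1)) = 0) := by
  have : CharZero A := charZero_of_injective_algebraMap (algebraMap C A).injective
  obtain ⟨hsha, hhat, hzero⟩ := mainTheorem4_general (C := C) (A := A)
  exact ⟨hsha, fun lam => hhat lam (by simpa using eq_or_ne lam 0),
    fun lam h => hzero lam _ (mul_inv_cancel₀ (neg_ne_zero.2 h))⟩
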